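/- Let $\Delta$ be a spherical building, that is, a simplicial complex together with a set of subcomplexes, called apartments, which cover $\Delta$ and satisfy: (B0) every apartment is a spherical Coxeter complex, i.e. isomorphic to the decomposition of the unit sphere of a Euclidean space by the reflecting hyperplanes of a finite group that is generated by reflections and fixes no nonzero vector; (B1) any two simplices lie in a common apartment; (B2) for any two apartments containing simplices $A$ and $B$ there is an isomorphism between them that fixes $A$ and $B$ pointwise. (The empty set is counted as a simplex, of dimension $-1$.) Simplices of $\Delta$ of maximal dimension are called chambers, those of codimension one panels. The thickness $\operatorname{th}(\Delta)$ is the largest $t\in\mathbb N\cup\{\infty\}$ such that every panel is a face of at least $t$ chambers. Two simplices are opposite if they are antipodal in some apartment containing them, and for a chamber $C$ the opposition complex $\operatorname{Opp}_\Delta(C)$ is the subcomplex of all simplices that are opposite to some face of $C$. Let $\operatorname{Aut}(\Delta)$ be the group of simplicial automorphisms of $\Delta$. Let $\Sigma$ be an apartment of $\Delta$, and suppose that $\operatorname{th}(\Delta)$ is larger than the number of chambers in $\Sigma$. Then there is a chamber $C$ of $\Delta$ such that $\Sigma\subseteq\operatorname{Opp}_\Delta(C)$. If moreover $\operatorname{Aut}(\Delta)$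 acts transitively on the set of chambers of $\Delta$, then for every chamber $C$ of $\Delta$ the complex $\operatorname{Opp}_\Delta(C)$ contains an apartment of $\Delta$. -/

import Mathlib

open scoped Pointwise

universe u

namespace Bldg

/-! ### Spherical Coxeter groups and their cell structure -/

/-- Euclidean `n`-space. -/
abbrev E (n : ℕ) : Type := EuclideanSpace ℝ (Fin n)

/-- The nonzero vectors `v` such that the orthogonal reflection in the linear hyperplane `v^⊥`
belongs to `W`.  The hyperplanes `v^⊥` are the walls of `W`. -/
def wallNormals {n : ℕ} (W : Subgroup (E n ≃ₗᵢ[ℝ] E n)) : Set (E n) :=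
  {v | v ≠ 0 ∧ (Submodule.span ℝ {v})ᗮ.reflection ∈ W}

/-- A spherical Coxeter group: a finite group of linear isometries that is generated by reflections
in hyperplanes and acts essentially, i.e. fixes no nonzero vector. -/
structure IsSphericalCoxeterGroup {n : ℕ} (W : Subgroup (E n ≃ₗᵢ[ℝ] E n)) : Prop where
  finite : Finite W
  generated :
    Subgroup.closure ((fun v => (Submodule.span ℝ {v})ᗮ.reflection) '' wallNormals W) = W
  essential : ∀ x : E n, (∀ g ∈ W, g x = x) → x = 0

/-- The open cell containing `x` of the decomposition of `E n` by the walls of `W`: the points that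
lie on the same side of, or on, each wall as `x` does. -/
def openCell {n : ℕ} (W : Subgroup (E n ≃ₗᵢ[ℝ] E n)) (x : E n) : Set (E n) :=
  {y | ∀ v ∈ wallNormals W, SignType.sign (inner ℝ v y) = SignType.sign (inner ℝ v x)}

/-- The cells cut out by the walls of `W`.  They are open convex cones; a cell other than `{0}` is
the cone over a cell of the unit sphere, and `{0}` stands for the empty cell of the sphere. -/
def cells {n : ℕ} (W : Subgroup (E n ≃ₗᵢ[ℝ] E n)) : Set (Set (E n)) :=
  Set.range (openCell W)

theorem neg_mem_cells {n : ℕ} {W : Subgroup (E n ≃ₗᵢ[ℝ] E n)} {A : Set (E n)}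
    (hA : A ∈ cells W) : -A ∈ cells W := by
  obtain ⟨x, rfl⟩ := hA
  refine ⟨-x, ?_⟩
  ext y
  simp only [openCell, Set.mem_neg, Set.mem_ofPred_eq, inner_neg_right, Left.sign_neg]
  refine forall₂_congr fun v _ => ?_
  constructor
  · intro h
    rw [h, neg_neg]
  · intro h
    rw [← h, neg_neg]

/-! ### Simplicial complexes -/

variable {V : Type u}

/-- All simplices of a complex, where the empty set is counted as a simplex, of dimension `-1`. -/
def simplices (K : PreAbstractSimplicialComplex V) : Set (Finset V) :=
  insert ∅ K.faces

open scoped Classical in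
/-- `f` restricts to an isomorphism of the complex `K` onto the complex `L`. -/
def IsSimplicialIso (K L : PreAbstractSimplicialComplex V) (f : V → V) : Prop :=
  Set.InjOn f {v | {v} ∈ K.faces} ∧ K.map f = L

/-- An identification of the simplicial complex `K` with the Coxeter complex of a spherical Coxeter
group `W`: a bijection of the simplices of `K` with the cells of `W` such that inclusion of
simplices corresponds to the face relation of cells. -/
structure CoxeterRealization (K : PreAbstractSimplicialComplex V) where
  n : ℕ
  W : Subgroup (E n ≃ₗᵢ[ℝ] E n)
  isCoxeter : IsSphericalCoxeterGroup W
  cell : Finset V → Set (E n)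
  bijOn : Set.BijOn cell (simplices K) (cells W)
  face_iff : ∀ s ∈ simplices K, ∀ t ∈ simplices K, s ⊆ t ↔ cell s ⊆ closure (cell t)

/-- `K` is (isomorphic to) a spherical Coxeter complex. -/
def IsSphericalCoxeterComplex (K : PreAbstractSimplicialComplex V) : Prop :=
  Nonempty (CoxeterRealization K)

/-- The simplices `A` and `B` of the spherical Coxeter complex `K` are antipodal. -/
def Antipodal (K : PreAbstractSimplicialComplex V) (A B : Finset V) : Prop :=
  A ∈ simplices K ∧ B ∈ simplices K ∧ ∃ R : CoxeterRealization K, R.cell B = -R.cell A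

/-! ### Spherical buildings -/

/-- A spherical building with vertex set `V`: a simplicial complex together with a set of
subcomplexes, the apartments, that cover it and satisfy the building axioms. -/
structure SphericalBuilding (V : Type u) where
  complex : AbstractSimplicialComplex V
  apartments : Set (PreAbstractSimplicialComplex V)
  apartment_le : ∀ S ∈ apartments, S ≤ complex.toPreAbstractSimplicialComplex
  covered : ∀ A ∈ complex, ∃ S ∈ apartments, A ∈ S
  /-- (B0) Each apartment is a spherical Coxeter complex. -/
  coxeter : ∀ S ∈ apartments, IsSphericalCoxeterComplex S
  /-- (B1) Any two simplices lie in a common apartment. -/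
  common : ∀ A ∈ simplices complex.toPreAbstractSimplicialComplex,
    ∀ B ∈ simplices complex.toPreAbstractSimplicialComplex,
      ∃ S ∈ apartments, A ∈ simplices S ∧ B ∈ simplices S
  /-- (B2) Two apartments containing `A` and `B` are isomorphic by an isomorphism that fixes `A`
  and `B` pointwise. -/
  iso : ∀ S ∈ apartments, ∀ T ∈ apartments, ∀ A B : Finset V,
    A ∈ simplices S → B ∈ simplices S → A ∈ simplices T → B ∈ simplices T →
      ∃ f : V → V, IsSimplicialIso S T f ∧ (∀ v ∈ A, f v = v) ∧ ∀ v ∈ B, f v = v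

namespace SphericalBuilding

variable (Δ : SphericalBuilding V)

/-- All simplices of the building, including the empty one. -/
abbrev simplexSet : Set (Finset V) := simplices Δ.complex.toPreAbstractSimplicialComplex

/-- A chamber is a simplex of maximal dimension. -/
def IsChamber (C : Finset V) : Prop :=
  C ∈ Δ.simplexSet ∧ ∀ A ∈ Δ.simplexSet, A.card ≤ C.card

/-- A panel is a simplex of codimension one. -/
def IsPanel (P : Finset V) : Prop :=
  P ∈ Δ.simplexSet ∧ ∃ C, Δ.IsChamber C ∧ P.card + 1 = C.card

/-- The set of chambers of `Δ` that belong to a subcomplex `X`. -/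
def chambersIn (X : PreAbstractSimplicialComplex V) : Set (Finset V) :=
  {C | Δ.IsChamber C ∧ C ∈ simplices X}

/-- The thickness: the largest `t ∈ ℕ ∪ {∞}` such that every panel is a face of at least `t`
chambers. -/
noncomputable def thickness : ℕ∞ :=
  sSup {t : ℕ∞ | ∀ P, Δ.IsPanel P → t ≤ Set.encard {C | Δ.IsChamber C ∧ P ⊆ C}}

/-- Two simplices are opposite if they are antipodal in some apartment containing them. -/
def Opposite (A B : Finset V) : Prop :=
  ∃ S ∈ Δ.apartments, Antipodal S A B

theorem Opposite.exists_face {Δ : SphericalBuilding V} {A B A' : Finset V}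
    (h : Δ.Opposite A B) (hA' : A' ⊆ A) : ∃ B' ⊆ B, Δ.Opposite A' B' := by
  obtain ⟨S, hS, hA, hB, R, hR⟩ := h
  have hA'S : A' ∈ simplices S := by
    rcases A'.eq_empty_or_nonempty with rfl | hne
    · exact Or.inl rfl
    · rcases hA with rfl | hA
      · exact absurd (Finset.subset_empty.mp hA') hne.ne_empty
      · exact Or.inr ((S.isRelLowerSet_faces hA).2 hA' hne)
  obtain ⟨B', hB', hc⟩ := R.bijOn.surjOn (neg_mem_cells (R.bijOn.mapsTo hA'S))
  refine ⟨B', ?_, S, hS, hA'S, hB', R, hc⟩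
  rw [R.face_iff B' hB' B hB, hc, hR, ← neg_closure, Set.neg_subset_neg]
  exact (R.face_iff A' hA'S A hA).1 hA'

/-- The opposition complex of `C`: the subcomplex of all simplices that are opposite to some face
of `C`. -/
def opp (C : Finset V) : PreAbstractSimplicialComplex V where
  faces := {A | A.Nonempty ∧ ∃ B ⊆ C, Δ.Opposite A B}
  isRelLowerSet_faces := by
    rintro A ⟨hA, B, hBC, hAB⟩
    refine ⟨hA, fun A' hA' hne => ⟨hne, ?_⟩⟩
    obtain ⟨B', hB', h⟩ := hAB.exists_face hA'
    exact ⟨B', hB'.trans hBC, h⟩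

/-- The group of simplicial automorphisms of `Δ`. -/
def aut : Subgroup (Equiv.Perm V) where
  carrier := {g | ∀ A : Finset V, A.map g.toEmbedding ∈ Δ.complex ↔ A ∈ Δ.complex}
  one_mem' A := by
    have h : A.map (1 : Equiv.Perm V).toEmbedding = A := Finset.map_refl
    rw [h]
  mul_mem' {g h} hg hh A := by
    have e : A.map (g * h).toEmbedding = (A.map h.toEmbedding).map g.toEmbedding := by
      rw [Finset.map_map]
      rfl
    rw [e, hg, hh]
  inv_mem' {g} hg A := by
    have e : (A.map (g⁻¹).toEmbedding).map g.toEmbedding = A := by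
      have h : (g⁻¹).toEmbedding.trans g.toEmbedding = Function.Embedding.refl V := by
        ext x
        exact g.apply_symm_apply x
      rw [Finset.map_map, h, Finset.map_refl]
    rw [← hg, e]

/-- The automorphism group acts transitively on the chambers. -/
def ChamberTransitive : Prop :=
  ∀ C D, Δ.IsChamber C → Δ.IsChamber D → ∃ g ∈ Δ.aut, C.map g.toEmbedding = D

end SphericalBuilding

end Bldg

/-! Measure chambers by gallery distance; it is at most the number `N` of walls of an apartment, and
distance `N` means opposite. Every panel `P` has, for each chamber `D`, a gate: one chamber on `P`
nearest to `D`, all others on `P` being exactly one step farther (`exists_gate`). Take a chamber `C`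
for which the sum of the distances to the chambers `D` of `Σ` is maximal. If `C` were not opposite
to some `D₀`, it would have a panel `P` on which `C` is the gate of `D₀`. The chambers of `Σ` have
at most as many gates on `P` as `Σ` has chambers, so thickness provides a chamber on `P` that is no
gate. It is at least as far as `C` from every `D` and strictly farther from `D₀`, a contradiction
(`exists_opposite_all`). Simplices opposite to faces of `C` then include all faces of the chambers
of `Σ`.

For the second claim, write the given chamber as `g C` with `g` an automorphism. The set of
apartments is not assumed to be invariant under `g`, so `g Σ` is replaced by an apartment `T`
containing the images of two opposite chambers of `Σ`. By convexity of apartments `g⁻¹ T` has all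
its chambers in `Σ` (`map_mem_simplices`), and `g` preserves gallery distance.

The geometry of one apartment is reduced to sign vectors with respect to the walls (`SignModel`).
The number of separating walls equals the gallery distance in the whole building because retractions
onto apartments do not lengthen galleries (`gdist_eq_sepCount`). -/

namespace Bldg

/-! ### Sign vectors of a finite family of linear forms -/

section SignVectors

variable {F ι : Type*} [NormedAddCommGroup F] [InnerProductSpace ℝ F]

/-- The signs of the inner products of `x` with the vectors of the family `v`. -/
noncomputable def signVec (v : ι → F) (x : F) (i : ι) : SignType :=
  SignType.sign (inner ℝ (v i) x : ℝ)

theorem eventually_sign_add_mul (a b : ℝ) :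
    ∀ᶠ ε in nhdsWithin (0 : ℝ) (Set.Ioi 0), SignType.sign (a + ε * b) =
      if SignType.sign a = 0 then SignType.sign b else SignType.sign a := by
  have hlim : Filter.Tendsto (fun ε : ℝ => a + ε * b) (nhdsWithin 0 (Set.Ioi 0)) (nhds a) := by
    have : Filter.Tendsto (fun ε : ℝ => a + ε * b) (nhds 0) (nhds (a + 0 * b)) :=
      Continuous.tendsto (by fun_prop) 0
    rw [zero_mul, add_zero] at this
    exact this.mono_left nhdsWithin_le_nhds
  rcases lt_trichotomy a 0 with ha | rfl | ha
  · filter_upwards [hlim.eventually (gt_mem_nhds ha)] with ε hε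
    simp [sign_neg ha, sign_neg hε]
  · filter_upwards [self_mem_nhdsWithin] with ε hε
    have hε : 0 < ε := hε
    simp [sign_mul, sign_pos hε]
  · filter_upwards [hlim.eventually (lt_mem_nhds ha)] with ε hε
    simp [sign_pos ha, sign_pos hε]

/-- Move from `x` a little towards `y`: nonzero signs at `x` survive, zero signs become those of
`y`. This is the Tits product of cells, the projection of one cell to the star of another. -/
theorem exists_signVec_comp [Finite ι] (v : ι → F) (x y : F) :
    ∃ z, ∀ i, signVec v z i = if signVec v x i = 0 then signVec v y i else signVec v x i := by
  obtain ⟨ε, hε⟩ := (Filter.eventually_all.2 fun i =>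
    eventually_sign_add_mul (inner ℝ (v i) x) (inner ℝ (v i) y)).exists
  refine ⟨x + ε • y, fun i => ?_⟩
  simpa [signVec, inner_add_right, inner_smul_right] using hε i

theorem signVec_neg (v : ι → F) (x : F) : signVec v (-x) = -signVec v x := by
  ext i
  simp [signVec, Left.sign_neg]

theorem exists_signVec_ne_zero [Finite ι] (v : ι → F) (hv : ∀ i, v i ≠ 0) :
    ∃ x, ∀ i, signVec v x i ≠ 0 := by
  classical
  have := Fintype.ofFinite ι
  suffices H : ∀ s : Finset ι, ∃ x, ∀ i ∈ s, signVec v x i ≠ 0 by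
    simpa using H Finset.univ
  intro s
  induction s using Finset.induction_on with
  | empty => exact ⟨0, by simp⟩
  | insert a s _ ih =>
    obtain ⟨x, hx⟩ := ih
    -- A perturbation in the direction `v a` leaves the hyperplane of `a`, since `v a` is not
    -- orthogonal to itself.
    obtain ⟨z, hz⟩ := exists_signVec_comp v x (v a)
    refine ⟨z, fun i hi => ?_⟩
    rw [hz i]
    split_ifs with h
    · rcases Finset.mem_insert.1 hi with rfl | hi
      · simp [signVec, hv i]
      · exact absurd h (hx i hi)
    · exact h

/-- The point where the segment from a point `x` off all hyperplanes to a point `y` leaves the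
open cell of `x`. -/
theorem exists_signVec_exit [Finite ι] (v : ι → F) (x y : F) (hx : ∀ i, signVec v x i ≠ 0)
    (hxy : signVec v y ≠ signVec v x) :
    ∃ z, (∀ i, signVec v z i = 0 ∨ signVec v z i = signVec v x i) ∧ (∃ i, signVec v z i = 0) ∧
      ∀ i, signVec v y i = signVec v x i → signVec v z i = signVec v x i := by
  set a : ι → ℝ := fun i => inner ℝ (v i) x with ha
  set b : ι → ℝ := fun i => inner ℝ (v i) y with hb
  have hsame : ∀ i, SignType.sign (b i) = SignType.sign (a i) → ∀ t : ℝ, 0 ≤ t → t ≤ 1 →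
      SignType.sign ((1 - t) * a i + t * b i) = SignType.sign (a i) := by
    intro i hi t h0 h1
    have hai : SignType.sign (a i) ≠ 0 := hx i
    rcases lt_trichotomy (a i) 0 with h | h | h
    · rw [sign_neg h] at hi ⊢
      rw [sign_eq_neg_one_iff] at hi ⊢
      rcases eq_or_lt_of_le h0 with rfl | h0
      · linarith
      · nlinarith
    · simp [h] at hai
    · rw [sign_pos h] at hi ⊢
      rw [sign_eq_one_iff] at hi ⊢
      rcases eq_or_lt_of_le h0 with rfl | h0
      · linarith
      · nlinarith
  obtain ⟨k, hk⟩ := Function.ne_iff.1 hxy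
  -- For such `i` the ratio is the parameter at which the segment from `x` to `y` meets the
  -- hyperplane of `i`; the smallest one gives the first crossing.
  obtain ⟨j, hj, hmin⟩ := Set.exists_min_image {i | signVec v y i ≠ signVec v x i}
    (fun i => |a i| / (|a i| + |b i|)) (Set.toFinite _) ⟨k, hk⟩
  set t := |a j| / (|a j| + |b j|) with ht
  have hapos : ∀ i, 0 < |a i| := fun i => abs_pos.2 (sign_ne_zero.1 (hx i))
  have hden : ∀ i, 0 < |a i| + |b i| := fun i => add_pos_of_pos_of_nonneg (hapos i) (abs_nonneg _)
  have ht0 : 0 ≤ t := by positivity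
  have ht1 : t ≤ 1 := by
    rw [ht, div_le_one (hden j)]
    linarith [abs_nonneg (b j)]
  have hopp : ∀ i, signVec v y i ≠ signVec v x i →
      (0 < a i ∧ b i ≤ 0) ∨ (a i < 0 ∧ 0 ≤ b i) := by
    intro i hi
    have hi : SignType.sign (b i) ≠ SignType.sign (a i) := hi
    rcases lt_trichotomy (a i) 0 with h | h | h
    · refine Or.inr ⟨h, not_lt.1 fun hlt => hi ?_⟩
      rw [sign_neg h, sign_neg hlt]
    · exact absurd (hx i) (by simp [signVec, show inner ℝ (v i) x = a i from rfl, h])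
    · refine Or.inl ⟨h, not_lt.1 fun hlt => hi ?_⟩
      rw [sign_pos h, sign_pos hlt]
  have hz : ∀ i, signVec v ((1 - t) • x + t • y) i = SignType.sign ((1 - t) * a i + t * b i) := by
    intro i
    simp [signVec, inner_add_right, inner_smul_right, ha, hb]
  refine ⟨(1 - t) • x + t • y, fun i => ?_, ⟨j, ?_⟩, fun i hi => ?_⟩
  · rw [hz]
    by_cases hi : signVec v y i = signVec v x i
    · exact Or.inr (hsame i hi t ht0 ht1)
    · have hm : t ≤ |a i| / (|a i| + |b i|) := hmin i hi
      rw [le_div_iff₀ (hden i)] at hm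
      rcases hopp i hi with ⟨h, h'⟩ | ⟨h, h'⟩
      · rw [abs_of_pos h, abs_of_nonpos h'] at hm
        have h0 : 0 ≤ (1 - t) * a i + t * b i := by linarith
        rcases eq_or_lt_of_le h0 with h0 | h0
        · left
          rw [← h0, sign_zero]
        · right
          rw [sign_pos h0]
          exact (sign_pos h).symm
      · rw [abs_of_neg h, abs_of_nonneg h'] at hm
        have h0 : (1 - t) * a i + t * b i ≤ 0 := by linarith
        rcases eq_or_lt_of_le h0 with h0 | h0
        · left
          rw [h0, sign_zero]
        · right
          rw [sign_neg h0]
          exact (sign_neg h).symm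
  · rw [hz, sign_eq_zero_iff]
    have hm : t * (|a j| + |b j|) = |a j| := div_mul_cancel₀ _ (hden j).ne'
    rcases hopp j hj with ⟨h, h'⟩ | ⟨h, h'⟩
    · rw [abs_of_pos h, abs_of_nonpos h'] at hm
      linarith
    · rw [abs_of_neg h, abs_of_nonneg h'] at hm
      linarith
  · rw [hz]
    exact hsame i hi t ht0 ht1

theorem exists_signVec_zero_ne_zero (v : ι → F) {i j : ι} (h : v j ∉ Submodule.span ℝ {v i}) :
    ∃ x, signVec v x i = 0 ∧ signVec v x j ≠ 0 := by
  by_contra! H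
  refine h ?_
  rw [← Submodule.orthogonal_orthogonal (Submodule.span ℝ {v i})]
  intro x hx
  have hxi : inner ℝ (v i) x = 0 := Submodule.mem_orthogonal_singleton_iff_inner_right.1 hx
  have := H x (by simp [signVec, hxi])
  rw [real_inner_comm]
  exact sign_eq_zero_iff.1 this

end SignVectors

/-! ### The walls of a spherical Coxeter group -/

section Walls

variable {n : ℕ} (W : Subgroup (E n ≃ₗᵢ[ℝ] E n))

/-- The walls of `W`, each given by the reflection in it. -/
def Wall : Type :=
  {g : W // ∃ v : E n, v ≠ 0 ∧ (Submodule.span ℝ {v})ᗮ.reflection = g.1}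

theorem finite_wall [Finite W] : Finite (Wall W) :=
  inferInstanceAs (Finite {g : W // ∃ v : E n, v ≠ 0 ∧ (Submodule.span ℝ {v})ᗮ.reflection = g.1})

variable {W}

/-- A normal vector of a wall. -/
noncomputable def Wall.normal (w : Wall W) : E n := w.2.choose

theorem Wall.normal_ne_zero (w : Wall W) : w.normal ≠ 0 := w.2.choose_spec.1

theorem Wall.reflection_normal (w : Wall W) :
    (Submodule.span ℝ {w.normal})ᗮ.reflection = w.1.1 := w.2.choose_spec.2

theorem Wall.normal_mem (w : Wall W) : w.normal ∈ wallNormals W :=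
  ⟨w.normal_ne_zero, by rw [w.reflection_normal]; exact w.1.2⟩

theorem mem_span_of_reflection_eq {x y : E n}
    (h : (Submodule.span ℝ {x})ᗮ.reflection = (Submodule.span ℝ {y})ᗮ.reflection) :
    x ∈ Submodule.span ℝ {y} := by
  have hx : (Submodule.span ℝ {x})ᗮ.reflection x = -x :=
    Submodule.reflection_orthogonalComplement_singleton_eq_neg x
  rw [h, Submodule.reflection_orthogonal_apply, neg_inj] at hx
  exact (Submodule.reflection_eq_self_iff x).1 hx

/-- Proportional normals define the same reflection. This is what makes distinct walls separable in
`SignModel.sep`. -/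
theorem Wall.normal_notMem_span {w w' : Wall W} (h : w ≠ w') :
    w'.normal ∉ Submodule.span ℝ {w.normal} := by
  intro hmem
  refine h (Subtype.ext (Subtype.ext ?_))
  rw [← w.reflection_normal, ← w'.reflection_normal]
  obtain ⟨c, hc⟩ := Submodule.mem_span_singleton.1 hmem
  have hc0 : c ≠ 0 := by
    rintro rfl
    exact w'.normal_ne_zero (by rw [← hc, zero_smul])
  have : Submodule.span ℝ {w'.normal} = Submodule.span ℝ {w.normal} := by
    rw [← hc, Submodule.span_singleton_smul_eq (IsUnit.mk0 c hc0)]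
  simp only [this]

theorem exists_wall_of_mem_wallNormals {u : E n} (hu : u ∈ wallNormals W) :
    ∃ (w : Wall W) (c : ℝ), u = c • w.normal := by
  let w : Wall W := ⟨⟨_, hu.2⟩, u, hu.1, rfl⟩
  obtain ⟨c, hc⟩ := Submodule.mem_span_singleton.1
    (mem_span_of_reflection_eq (x := u) (y := w.normal) w.reflection_normal.symm)
  exact ⟨w, c, hc.symm⟩

/-- One normal per wall suffices: any other normal is a multiple of it, and signs are
multiplicative. -/
theorem mem_openCell_iff {x y : E n} :
    y ∈ openCell W x ↔ signVec (Wall.normal (W := W)) y = signVec Wall.normal x := by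
  constructor
  · intro h
    ext w
    exact h _ w.normal_mem
  · intro h u hu
    obtain ⟨w, c, rfl⟩ := exists_wall_of_mem_wallNormals hu
    have := congrFun h w
    simp only [signVec] at this
    simp [inner_smul_left, sign_mul, this]

theorem openCell_eq_iff {x y : E n} :
    openCell W x = openCell W y ↔
      signVec (Wall.normal (W := W)) x = signVec Wall.normal y := by
  constructor
  · intro h
    rw [← mem_openCell_iff, ← h, mem_openCell_iff]
  · intro h
    ext z
    rw [mem_openCell_iff, mem_openCell_iff, h]

theorem neg_openCell (x : E n) : -openCell W x = openCell W (-x) := by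
  ext z
  rw [Set.mem_neg, mem_openCell_iff, mem_openCell_iff, signVec_neg, signVec_neg, neg_eq_iff_eq_neg]

/-- A nonzero sign is an open condition, so it passes from a limit point to nearby points of the
cell. Conversely `x' + ε • y` lies in the cell of `y` for every `ε > 0` and tends to `x'`. -/
theorem openCell_subset_closure_iff {x y : E n} :
    openCell W x ⊆ closure (openCell W y) ↔
      ∀ w : Wall W, signVec Wall.normal x w = 0 ∨
        signVec Wall.normal x w = signVec Wall.normal y w := by
  constructor
  · intro h w
    have hx : x ∈ closure (openCell W y) := h (mem_openCell_iff.2 rfl)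
    have hcont : Continuous fun z : E n => (inner ℝ w.normal z : ℝ) := by fun_prop
    rw [or_iff_not_imp_left]
    intro h0
    rcases lt_trichotomy (inner ℝ w.normal x : ℝ) 0 with hs | hs | hs
    · obtain ⟨z, hz, hzy⟩ := mem_closure_iff.1 hx _ (isOpen_lt hcont continuous_const) hs
      rw [mem_openCell_iff] at hzy
      rw [← congrFun hzy w]
      exact (sign_neg hs).trans (sign_neg hz).symm
    · exact absurd (by simp [signVec, hs]) h0
    · obtain ⟨z, hz, hzy⟩ := mem_closure_iff.1 hx _ (isOpen_lt continuous_const hcont) hs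
      rw [mem_openCell_iff] at hzy
      rw [← congrFun hzy w]
      exact (sign_pos hs).trans (sign_pos hz).symm
  · intro h x' hx'
    rw [mem_openCell_iff] at hx'
    have hlim : Filter.Tendsto (fun ε : ℝ => x' + ε • y) (nhdsWithin 0 (Set.Ioi 0)) (nhds x') := by
      have : Filter.Tendsto (fun ε : ℝ => x' + ε • y) (nhds 0) (nhds (x' + (0 : ℝ) • y)) :=
        Continuous.tendsto (by fun_prop) 0
      rw [zero_smul, add_zero] at this
      exact this.mono_left nhdsWithin_le_nhds
    refine mem_closure_of_tendsto hlim ?_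
    filter_upwards [self_mem_nhdsWithin] with ε hε
    have hε : 0 < ε := hε
    rw [mem_openCell_iff]
    ext w
    have hw := h w
    rw [← hx'] at hw
    simp only [signVec, inner_add_right, inner_smul_right] at hw ⊢
    rcases lt_trichotomy (inner ℝ w.normal x' : ℝ) 0 with hs | hs | hs
    · have hy := hw.resolve_left (by simp [sign_eq_zero_iff, hs.ne])
      rw [← hy, sign_neg hs]
      rw [sign_neg hs] at hy
      have hy := sign_eq_neg_one_iff.1 hy.symm
      exact sign_neg (by nlinarith)
    · rw [hs, zero_add, sign_mul, sign_pos hε, one_mul]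
    · have hy := hw.resolve_left (by simp [sign_eq_zero_iff, hs.ne'])
      rw [← hy, sign_pos hs]
      rw [sign_pos hs] at hy
      have hy := sign_eq_one_iff.1 hy.symm
      exact sign_pos (by positivity)

end Walls

end Bldg

namespace Bldg

variable {V : Type u}

/-! ### Simplices of a spherical Coxeter complex as sign vectors -/

theorem mem_simplices_of_subset {K : PreAbstractSimplicialComplex V} {A B : Finset V}
    (hB : B ∈ simplices K) (h : A ⊆ B) : A ∈ simplices K := by
  rcases A.eq_empty_or_nonempty with rfl | hne
  · exact Or.inl rfl
  · rcases hB with rfl | hB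
    · exact absurd (Finset.subset_empty.mp h) hne.ne_empty
    · exact Or.inr ((K.isRelLowerSet_faces hB).2 h hne)

/-- A labelling of the simplices of `K` by the sign vectors of an arrangement of hyperplanes indexed
by `ι`, recorded through the properties of sign vectors that are used below. -/
structure SignModel (ι : Type*) (K : PreAbstractSimplicialComplex V) where
  sgn : Finset V → ι → SignType
  subset_iff : ∀ A ∈ simplices K, ∀ B ∈ simplices K,
    A ⊆ B ↔ ∀ i, sgn A i = 0 ∨ sgn A i = sgn B i
  neg : ∀ A ∈ simplices K, ∃ B ∈ simplices K, sgn B = -sgn A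
  comp : ∀ A ∈ simplices K, ∀ B ∈ simplices K, ∃ C ∈ simplices K,
    ∀ i, sgn C i = if sgn A i = 0 then sgn B i else sgn A i
  exit : ∀ A ∈ simplices K, ∀ B ∈ simplices K, (∀ i, sgn A i ≠ 0) → sgn B ≠ sgn A →
    ∃ C ∈ simplices K, C ⊆ A ∧ (∃ i, sgn C i = 0) ∧ ∀ i, sgn B i = sgn A i → sgn C i = sgn A i
  sep : ∀ i j, i ≠ j → ∃ A ∈ simplices K, sgn A i = 0 ∧ sgn A j ≠ 0
  exists_ne_zero : ∃ A ∈ simplices K, ∀ i, sgn A i ≠ 0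

namespace CoxeterRealization

variable {K : PreAbstractSimplicialComplex V} (R : CoxeterRealization K)

/-- A point of the cell of the simplex `A`. -/
noncomputable def point (A : Finset V) : E R.n :=
  open scoped Classical in
  if h : A ∈ simplices K then (R.bijOn.mapsTo h).choose else 0

theorem openCell_point {A : Finset V} (hA : A ∈ simplices K) :
    openCell R.W (R.point A) = R.cell A := by
  rw [point, dif_pos hA]
  exact (R.bijOn.mapsTo hA).choose_spec

/-- The position of the simplex `A` with respect to the walls. -/
noncomputable def sgn (A : Finset V) : Wall R.W → SignType :=
  signVec Wall.normal (R.point A)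

theorem exists_sgn_eq (x : E R.n) : ∃ A ∈ simplices K, R.sgn A = signVec Wall.normal x := by
  obtain ⟨A, hA, h⟩ := R.bijOn.surjOn ⟨x, rfl⟩
  refine ⟨A, hA, ?_⟩
  rw [← R.openCell_point hA, openCell_eq_iff] at h
  exact h

theorem subset_iff_sgn {A B : Finset V} (hA : A ∈ simplices K) (hB : B ∈ simplices K) :
    A ⊆ B ↔ ∀ i, R.sgn A i = 0 ∨ R.sgn A i = R.sgn B i := by
  rw [R.face_iff A hA B hB, ← R.openCell_point hA, ← R.openCell_point hB,
    openCell_subset_closure_iff]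
  rfl

instance : Finite (Wall R.W) :=
  have := R.isCoxeter.finite
  finite_wall R.W

/-- The labelling of simplices by sign vectors that comes from a realization. -/
noncomputable def signModel : SignModel (Wall R.W) K where
  sgn := R.sgn
  subset_iff _ hA _ hB := R.subset_iff_sgn hA hB
  neg A _ := by
    obtain ⟨B, hB, h⟩ := R.exists_sgn_eq (-R.point A)
    exact ⟨B, hB, by rw [h, signVec_neg]; rfl⟩
  comp A _ B _ := by
    obtain ⟨z, hz⟩ := exists_signVec_comp (Wall.normal (W := R.W)) (R.point A) (R.point B)
    obtain ⟨C, hC, h⟩ := R.exists_sgn_eq z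
    exact ⟨C, hC, fun i => by rw [h, hz]; rfl⟩
  exit A hA B _ hne hAB := by
    obtain ⟨z, hz, h0, hz'⟩ := exists_signVec_exit Wall.normal (R.point A) (R.point B) hne hAB
    obtain ⟨C, hC, h⟩ := R.exists_sgn_eq z
    refine ⟨C, hC, ?_, ?_, ?_⟩
    · rw [R.subset_iff_sgn hC hA, h]
      exact hz
    · rw [h]
      exact h0
    · rw [h]
      exact hz'
  sep i j hij := by
    obtain ⟨x, hx⟩ := exists_signVec_zero_ne_zero Wall.normal (Wall.normal_notMem_span hij)
    obtain ⟨C, hC, h⟩ := R.exists_sgn_eq x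
    exact ⟨C, hC, by rw [h]; exact hx⟩
  exists_ne_zero := by
    obtain ⟨x, hx⟩ := exists_signVec_ne_zero (Wall.normal (W := R.W)) Wall.normal_ne_zero
    obtain ⟨C, hC, h⟩ := R.exists_sgn_eq x
    exact ⟨C, hC, by rw [h]; exact hx⟩

theorem antipodal_of_sgn {A B : Finset V} (hA : A ∈ simplices K) (hB : B ∈ simplices K)
    (h : R.sgn B = -R.sgn A) : Antipodal K A B := by
  refine ⟨hA, hB, R, ?_⟩
  rw [← R.openCell_point hA, ← R.openCell_point hB, neg_openCell, openCell_eq_iff, signVec_neg]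
  exact h

end CoxeterRealization

theorem _root_.SignType.eq_neg_of_ne {a b : SignType} (ha : a ≠ 0) (hb : b ≠ 0) (h : a ≠ b) :
    a = -b := by
  revert a b
  decide

/-! ### Chambers and panels in terms of sign vectors -/

namespace SignModel

variable {ι : Type*} {K : PreAbstractSimplicialComplex V} (M : SignModel ι K)

theorem sgn_inj {A B : Finset V} (hA : A ∈ simplices K) (hB : B ∈ simplices K)
    (h : M.sgn A = M.sgn B) : A = B :=
  Finset.Subset.antisymm ((M.subset_iff A hA B hB).2 fun i => Or.inr (congrFun h i))
    ((M.subset_iff B hB A hA).2 fun i => Or.inr (congrFun h i).symm)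

/-- The simplex `A` lies on no wall. -/
def IsOpen (A : Finset V) : Prop :=
  A ∈ simplices K ∧ ∀ i, M.sgn A i ≠ 0

variable {M}

theorem IsOpen.eq_of_subset {A B : Finset V} (hA : M.IsOpen A) (hB : B ∈ simplices K)
    (h : A ⊆ B) : A = B :=
  M.sgn_inj hA.1 hB (funext fun i => ((M.subset_iff A hA.1 B hB).1 h i).resolve_left (hA.2 i))

theorem exists_isOpen_superset (M : SignModel ι K) {A : Finset V} (hA : A ∈ simplices K) :
    ∃ B, M.IsOpen B ∧ A ⊆ B := by
  obtain ⟨G, hG, hG0⟩ := M.exists_ne_zero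
  obtain ⟨C, hC, h⟩ := M.comp A hA G hG
  refine ⟨C, ⟨hC, fun i => ?_⟩, (M.subset_iff A hA C hC).2 fun i => ?_⟩
  · rw [h i]
    split_ifs with h0
    exacts [hG0 i, h0]
  · rw [h i]
    split_ifs with h0
    exacts [Or.inl h0, Or.inr rfl]

theorem IsOpen.exists_neg {A : Finset V} (hA : M.IsOpen A) :
    ∃ B, M.IsOpen B ∧ M.sgn B = -M.sgn A := by
  obtain ⟨B, hB, h⟩ := M.neg A hA.1
  refine ⟨B, ⟨hB, fun i => ?_⟩, h⟩
  rw [h, Pi.neg_apply, Ne, SignType.neg_eq_zero_iff]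
  exact hA.2 i

/-- A codimension one face of an open simplex lies on exactly one wall. -/
theorem IsOpen.exists_wall {F G : Finset V} (hG : M.IsOpen G) (hFG : F ⊆ G)
    (hcard : F.card + 1 = G.card) : ∃ i, ∀ j, M.sgn F j = 0 ↔ j = i := by
  have hF := mem_simplices_of_subset hG.1 hFG
  have hsub := (M.subset_iff F hF G hG.1).1 hFG
  obtain ⟨i, hi⟩ : ∃ i, M.sgn F i = 0 := by
    by_contra! H
    have : F = G := IsOpen.eq_of_subset ⟨hF, H⟩ hG.1 hFG
    subst this
    omega
  refine ⟨i, fun j => ⟨fun hj => ?_, fun h => h ▸ hi⟩⟩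
  by_contra hij
  -- If `F` lay on two walls `i` and `j`, one could leave `G` through a face that contains `F` and
  -- lies off `j`. That face is strictly between `F` and `G`, against codimension one. The target of
  -- the move is the product of `F` with a simplex on `i` that is on the side of `G` at `j`.
  obtain ⟨Q, hQ, hQi, hQj⟩ : ∃ Q ∈ simplices K, M.sgn Q i = 0 ∧ M.sgn Q j = M.sgn G j := by
    obtain ⟨Q, hQ, hQi, hQj⟩ := M.sep i j (Ne.symm hij)
    by_cases h : M.sgn Q j = M.sgn G j
    · exact ⟨Q, hQ, hQi, h⟩
    · obtain ⟨Q', hQ', hneg⟩ := M.neg Q hQ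
      refine ⟨Q', hQ', by rw [hneg, Pi.neg_apply, hQi, neg_zero], ?_⟩
      rw [hneg, Pi.neg_apply]
      exact (SignType.eq_neg_of_ne (hG.2 j) hQj (Ne.symm h)).symm
  obtain ⟨Q', hQ', hq⟩ := M.comp F hF Q hQ
  have hne : M.sgn Q' ≠ M.sgn G := by
    intro h
    refine hG.2 i ?_
    rw [← h, hq, if_pos hi, hQi]
  obtain ⟨Z, hZ, hZG, ⟨k, hk⟩, hZs⟩ := M.exit G hG.1 Q' hQ' hG.2 hne
  have hFZ : F ⊆ Z := by
    refine (M.subset_iff F hF Z hZ).2 fun l => ?_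
    rcases hsub l with h | h
    · exact Or.inl h
    · have h0 : M.sgn F l ≠ 0 := by
        rw [h]
        exact hG.2 l
      exact Or.inr (by rw [hZs l (by rw [hq, if_neg h0, h]), h])
  have h1 : F ≠ Z := by
    rintro rfl
    exact hG.2 j (by rw [← hZs j (by rw [hq, if_pos hj, hQj]), hj])
  have h2 : Z ≠ G := by
    rintro rfl
    exact hG.2 k hk
  have := Finset.card_lt_card (hFZ.ssubset_of_ne h1)
  have := Finset.card_lt_card (hZG.ssubset_of_ne h2)
  omega

/-- Distinct open simplices with a common codimension one face are separated by exactly one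
wall. -/
theorem IsOpen.exists_flip {F X Y : Finset V} (hX : M.IsOpen X) (hY : M.IsOpen Y) (hXY : X ≠ Y)
    (hFX : F ⊆ X) (hFY : F ⊆ Y) (hcard : F.card + 1 = X.card) :
    ∃ i, M.sgn F i = 0 ∧ M.sgn Y i ≠ M.sgn X i ∧ ∀ j, j ≠ i → M.sgn Y j = M.sgn X j := by
  obtain ⟨i, hi⟩ := hX.exists_wall hFX hcard
  have hF := mem_simplices_of_subset hX.1 hFX
  have key : ∀ j, j ≠ i → M.sgn Y j = M.sgn X j := fun j hj => by
    rw [← ((M.subset_iff F hF X hX.1).1 hFX j).resolve_left fun h => hj ((hi j).1 h),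
      ← ((M.subset_iff F hF Y hY.1).1 hFY j).resolve_left fun h => hj ((hi j).1 h)]
  refine ⟨i, (hi i).2 rfl, fun h => hXY (M.sgn_inj hX.1 hY.1 (funext fun j => ?_)), key⟩
  by_cases hj : j = i
  · rw [hj, h]
  · exact (key j hj).symm

/-- A codimension one simplex is a face of at most two open simplices. -/
theorem IsOpen.eq_of_ne_of_ne {F X Y Z : Finset V} (hX : M.IsOpen X) (hY : M.IsOpen Y)
    (hZ : M.IsOpen Z) (hFX : F ⊆ X) (hFY : F ⊆ Y) (hFZ : F ⊆ Z) (hcard : F.card + 1 = Y.card)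
    (hXY : X ≠ Y) (hZY : Z ≠ Y) : X = Z := by
  obtain ⟨i, hi, hne, h⟩ := hY.exists_flip hX hXY.symm hFY hFX hcard
  obtain ⟨i', hi', hne', h'⟩ := hY.exists_flip hZ hZY.symm hFY hFZ hcard
  obtain ⟨k, hk⟩ := hY.exists_wall hFY hcard
  obtain rfl := (hk i).1 hi
  obtain rfl := (hk i').1 hi'
  refine M.sgn_inj hX.1 hZ.1 (funext fun j => ?_)
  by_cases hj : j = i'
  · rw [hj, SignType.eq_neg_of_ne (hX.2 _) (hY.2 _) hne,
      SignType.eq_neg_of_ne (hZ.2 _) (hY.2 _) hne']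
  · rw [h j hj, h' j hj]

/-- Every codimension one face of an open simplex is a face of a second one. -/
theorem IsOpen.exists_adjacent {F X : Finset V} (hX : M.IsOpen X) (hFX : F ⊆ X)
    (hcard : F.card + 1 = X.card) :
    ∃ Y, M.IsOpen Y ∧ F ⊆ Y ∧ Y ≠ X ∧ Y.card = X.card := by
  classical
  have hF := mem_simplices_of_subset hX.1 hFX
  obtain ⟨i, hi⟩ := hX.exists_wall hFX hcard
  obtain ⟨X', hX', hneg⟩ := hX.exists_neg
  -- `Y` is the projection of the antipode of `X` to the star of `F`; it differs from `X` only at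
  -- the wall of `F`.
  obtain ⟨Y, hY, hYs⟩ := M.comp F hF X' hX'.1
  have hYopen : M.IsOpen Y := by
    refine ⟨hY, fun j => ?_⟩
    rw [hYs j]
    split_ifs with h
    exacts [hX'.2 j, h]
  have hFY : F ⊆ Y := by
    refine (M.subset_iff F hF Y hY).2 fun j => ?_
    rw [hYs j]
    split_ifs with h
    exacts [Or.inl h, Or.inr rfl]
  have hYi : M.sgn Y i = -M.sgn X i := by
    rw [hYs i, if_pos ((hi i).2 rfl), hneg, Pi.neg_apply]
  refine ⟨Y, hYopen, hFY, ?_, ?_⟩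
  · rintro rfl
    have := hX.2 i
    revert this hYi
    generalize M.sgn Y i = a
    revert a
    decide
  · have hne : F ≠ Y := by
      rintro rfl
      exact hYopen.2 i ((hi i).2 rfl)
    obtain ⟨a, haY, haF⟩ := Finset.exists_of_ssubset (hFY.ssubset_of_ne hne)
    -- One more vertex already takes `F` off its only wall, so `insert a F` is open and equals `Y`;
    -- this gives the cardinality of `Y`.
    have hI : insert a F ⊆ Y := Finset.insert_subset haY hFY
    have hIm := mem_simplices_of_subset hY hI
    have hIo : M.IsOpen (insert a F) := by
      refine ⟨hIm, fun j hj => ?_⟩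
      have h1 := (M.subset_iff F hF _ hIm).1 (Finset.subset_insert a F)
      have hji : j = i := by
        rcases h1 j with h | h
        · exact (hi j).1 h
        · exact (hi j).1 (h.trans hj)
      subst hji
      refine haF ?_
      have : insert a F = F := by
        refine M.sgn_inj hIm hF (funext fun l => ?_)
        by_cases hl : l = j
        · rw [hl, hj, (hi j).2 rfl]
        · exact ((h1 l).resolve_left fun h => hl ((hi l).1 h)).symm
      rw [← this]
      exact Finset.mem_insert_self a F
    rw [← hIo.eq_of_subset hY hI, Finset.card_insert_of_notMem haF, hcard]

/-- An open simplex other than `D` has a codimension one face whose wall separates it from `D`. -/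
theorem IsOpen.exists_face_toward {G D : Finset V} (hG : M.IsOpen G) (hD : M.IsOpen D)
    (h : D ≠ G) :
    ∃ F ⊆ G, F.card + 1 = G.card ∧ ∃ i, M.sgn F i = 0 ∧ M.sgn D i ≠ M.sgn G i := by
  classical
  obtain ⟨Z, hZ, hZG, ⟨k, hk⟩, hZs⟩ := M.exit G hG.1 D hD.1 hG.2 fun e => h (M.sgn_inj hD.1 hG.1 e)
  have hne : Z ≠ G := by
    rintro rfl
    exact hG.2 k hk
  obtain ⟨a, haG, haZ⟩ := Finset.exists_of_ssubset (hZG.ssubset_of_ne hne)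
  have hcard := Finset.card_erase_add_one haG
  have hFG := Finset.erase_subset a G
  have hF := mem_simplices_of_subset hG.1 hFG
  obtain ⟨i, hi⟩ := hG.exists_wall hFG hcard
  refine ⟨G.erase a, hFG, hcard, i, (hi i).2 rfl, fun hDi => ?_⟩
  -- Were `D` on the side of `G` at the wall `i` of this face, the exit face `Z` would be off that
  -- wall, although it is a face of a simplex lying in it.
  have hZF : Z ⊆ G.erase a := Finset.subset_erase.2 ⟨hZG, haZ⟩
  have hZi := hZs i hDi
  rcases (M.subset_iff Z hZ _ hF).1 hZF i with h0 | h0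
  · exact hG.2 i (by rw [← hZi, h0])
  · exact hG.2 i (by rw [← hZi, h0, (hi i).2 rfl])

/-! ### Counting the walls that separate two chambers -/

variable [Fintype ι]

variable (M) in
/-- The number of walls that separate `A` from `B`. -/
def sepCount (A B : Finset V) : ℕ :=
  (Finset.univ.filter fun i => M.sgn A i ≠ M.sgn B i).card

theorem sepCount_self (A : Finset V) : M.sepCount A A = 0 := by
  simp [sepCount]

theorem sepCount_flip {X Y D : Finset V} {i : ι} (hX : M.sgn D i = M.sgn X i)
    (hY : M.sgn Y i ≠ M.sgn X i) (h : ∀ j, j ≠ i → M.sgn Y j = M.sgn X j) :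
    M.sepCount Y D = M.sepCount X D + 1 := by
  classical
  rw [sepCount, sepCount, ← Finset.card_insert_of_notMem (a := i) (by simp [hX])]
  congr 1
  ext j
  by_cases hj : j = i
  · subst hj
    simp [hX, hY]
  · simp [hj, h j hj]

/-- The numbers of walls separating two adjacent open simplices from a third one differ
by one. -/
theorem IsOpen.sepCount_adjacent {F X Y D : Finset V} (hX : M.IsOpen X) (hY : M.IsOpen Y)
    (hD : M.IsOpen D) (hXY : X ≠ Y) (hFX : F ⊆ X) (hFY : F ⊆ Y) (hcard : F.card + 1 = X.card) :
    M.sepCount Y D = M.sepCount X D + 1 ∨ M.sepCount X D = M.sepCount Y D + 1 := by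
  obtain ⟨i, -, hne, h⟩ := hX.exists_flip hY hXY hFX hFY hcard
  by_cases hDi : M.sgn D i = M.sgn X i
  · exact Or.inl (sepCount_flip hDi hne h)
  · refine Or.inr (sepCount_flip ?_ hne.symm fun j hj => (h j hj).symm)
    rw [SignType.eq_neg_of_ne (hD.2 i) (hX.2 i) hDi, SignType.eq_neg_of_ne (hY.2 i) (hX.2 i) hne]

/-- An open simplex other than `D` is adjacent to one that is closer to `D`. -/
theorem IsOpen.exists_closer {X D : Finset V} (hX : M.IsOpen X) (hD : M.IsOpen D) (h : D ≠ X) :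
    ∃ F Y, M.IsOpen Y ∧ F ⊆ X ∧ F ⊆ Y ∧ F.card + 1 = X.card ∧ Y.card = X.card ∧ Y ≠ X ∧
      M.sepCount X D = M.sepCount Y D + 1 := by
  obtain ⟨F, hFX, hcard, i, hi, hne⟩ := hX.exists_face_toward hD h
  obtain ⟨Y, hY, hFY, hYX, hYc⟩ := hX.exists_adjacent hFX hcard
  refine ⟨F, Y, hY, hFX, hFY, hcard, hYc, hYX, ?_⟩
  obtain ⟨i', hi', hne', h'⟩ := hX.exists_flip hY hYX.symm hFX hFY hcard
  obtain ⟨k, hk⟩ := hX.exists_wall hFX hcard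
  obtain rfl := (hk i).1 hi
  obtain rfl := (hk i').1 hi'
  refine sepCount_flip ?_ hne'.symm fun j hj => (h' j hj).symm
  rw [SignType.eq_neg_of_ne (hD.2 _) (hX.2 _) hne, SignType.eq_neg_of_ne (hY.2 _) (hX.2 _) hne']

/-- An open simplex that is not antipodal to `D` is adjacent to one that is farther from `D`. -/
theorem IsOpen.exists_farther {X D : Finset V} (hX : M.IsOpen X) (hD : M.IsOpen D)
    (h : M.sgn X ≠ -M.sgn D) :
    ∃ F Y, M.IsOpen Y ∧ F ⊆ X ∧ F ⊆ Y ∧ F.card + 1 = X.card ∧ Y.card = X.card ∧ Y ≠ X ∧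
      M.sepCount Y D = M.sepCount X D + 1 := by
  -- Moving away from `D` is moving towards its antipode `D'`.
  obtain ⟨D', hD', hneg⟩ := hD.exists_neg
  have hne : D' ≠ X := by
    rintro rfl
    exact h hneg
  obtain ⟨F, hFX, hcard, i, hi, hne⟩ := hX.exists_face_toward hD' hne
  obtain ⟨Y, hY, hFY, hYX, hYc⟩ := hX.exists_adjacent hFX hcard
  refine ⟨F, Y, hY, hFX, hFY, hcard, hYc, hYX, ?_⟩
  obtain ⟨i', hi', hne', h'⟩ := hX.exists_flip hY hYX.symm hFX hFY hcard
  obtain ⟨k, hk⟩ := hX.exists_wall hFX hcard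
  obtain rfl := (hk i).1 hi
  obtain rfl := (hk i').1 hi'
  refine sepCount_flip ?_ hne' h'
  have := SignType.eq_neg_of_ne (hD'.2 _) (hX.2 _) hne
  rw [hneg, Pi.neg_apply, neg_inj] at this
  exact this

theorem IsOpen.card_eq {X D : Finset V} (hX : M.IsOpen X) (hD : M.IsOpen D) :
    X.card = D.card := by
  induction hn : M.sepCount X D using Nat.strong_induction_on generalizing X with
  | _ n ih =>
    by_cases h : D = X
    · rw [h]
    · obtain ⟨F, Y, hY, -, -, -, hc, -, hs⟩ := hX.exists_closer hD h
      rw [← hc]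
      exact ih _ (by omega) hY rfl

theorem sepCount_le (A B : Finset V) : M.sepCount A B ≤ Fintype.card ι :=
  Finset.card_le_univ _

/-- Opposition of chambers becomes a condition on a number, hence on gallery distance, which does
not depend on the apartment. -/
theorem IsOpen.sgn_eq_neg_iff {X D : Finset V} (hX : M.IsOpen X) (hD : M.IsOpen D) :
    M.sgn X = -M.sgn D ↔ M.sepCount X D = Fintype.card ι := by
  rw [sepCount, Finset.card_eq_iff_eq_univ, Finset.filter_eq_self]
  constructor
  · intro h i _
    have := hD.2 i
    rw [h, Pi.neg_apply]
    revert this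
    generalize M.sgn D i = a
    revert a
    decide
  · intro h
    exact funext fun i => SignType.eq_neg_of_ne (hX.2 i) (hD.2 i) (h i (Finset.mem_univ i))

end SignModel

end Bldg

namespace Bldg

variable {V : Type u}

/-- Each wall separates `X` from exactly one of two opposite chambers. Hence every chamber of an
apartment is on a minimal gallery between them. -/
theorem SignModel.sepCount_add_of_eq_neg {ι : Type*} [Fintype ι]
    {K : PreAbstractSimplicialComplex V} {M : SignModel ι K} {X D D' : Finset V}
    (hX : M.IsOpen X) (hD : M.IsOpen D) (h : M.sgn D' = -M.sgn D) :
    M.sepCount X D + M.sepCount X D' = Fintype.card ι := by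
  classical
  have key : ∀ i, M.sgn X i ≠ M.sgn D' i ↔ ¬ M.sgn X i ≠ M.sgn D i := by
    intro i
    have h1 := hX.2 i
    have h2 := hD.2 i
    rw [h, Pi.neg_apply]
    revert h1 h2
    generalize M.sgn X i = a
    generalize M.sgn D i = b
    revert a b
    decide
  rw [SignModel.sepCount, SignModel.sepCount]
  simp only [key]
  rw [Finset.card_filter_add_card_filter_not, Finset.card_univ]

section Isomorphisms

open scoped Classical

/-! ### Isomorphisms of complexes -/

variable {K L J : PreAbstractSimplicialComplex V} {f g : V → V}

theorem singleton_mem_faces {A : Finset V} (hA : A ∈ simplices K) {v : V} (hv : v ∈ A) :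
    {v} ∈ K.faces :=
  (mem_simplices_of_subset hA (Finset.singleton_subset_iff.2 hv)).resolve_left
    (Finset.singleton_ne_empty v)

namespace IsSimplicialIso

theorem image_mem (h : IsSimplicialIso K L f) {A : Finset V} (hA : A ∈ simplices K) :
    A.image f ∈ simplices L := by
  rcases hA with rfl | hA
  · exact Or.inl (Finset.image_empty f)
  · rw [← h.2]
    exact Or.inr ⟨A, hA, rfl⟩

theorem exists_image_eq (h : IsSimplicialIso K L f) {B : Finset V} (hB : B ∈ simplices L) :
    ∃ A ∈ simplices K, A.image f = B := by
  rcases hB with rfl | hB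
  · exact ⟨∅, Or.inl rfl, Finset.image_empty f⟩
  · rw [← h.2] at hB
    obtain ⟨A, hA, rfl⟩ := hB
    exact ⟨A, Or.inr hA, rfl⟩

theorem injOn (h : IsSimplicialIso K L f) {A : Finset V} (hA : A ∈ simplices K) :
    Set.InjOn f A :=
  h.1.mono fun _ hv => singleton_mem_faces hA hv

theorem card_image (h : IsSimplicialIso K L f) {A : Finset V} (hA : A ∈ simplices K) :
    (A.image f).card = A.card :=
  Finset.card_image_of_injOn (h.injOn hA)

theorem subset_of_image_subset (h : IsSimplicialIso K L f) {A B : Finset V}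
    (hA : A ∈ simplices K) (hB : B ∈ simplices K) (hAB : A.image f ⊆ B.image f) : A ⊆ B := by
  intro v hv
  obtain ⟨w, hw, hwv⟩ := Finset.mem_image.1 (hAB (Finset.mem_image_of_mem f hv))
  rwa [← h.1 (singleton_mem_faces hB hw) (singleton_mem_faces hA hv) hwv]

theorem image_injective (h : IsSimplicialIso K L f) {A B : Finset V}
    (hA : A ∈ simplices K) (hB : B ∈ simplices K) (hAB : A.image f = B.image f) : A = B :=
  (h.subset_of_image_subset hA hB hAB.subset).antisymm
    (h.subset_of_image_subset hB hA hAB.symm.subset)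

theorem comp (hf : IsSimplicialIso K L f) (hg : IsSimplicialIso L J g) :
    IsSimplicialIso K J (g ∘ f) := by
  refine ⟨fun v hv w hw hvw => hf.1 hv hw (hg.1 ?_ ?_ hvw), ?_⟩
  · exact (hf.image_mem (Or.inr hv)).resolve_left (by simp)
  · exact (hf.image_mem (Or.inr hw)).resolve_left (by simp)
  · rw [← hg.2, ← hf.2]
    refine PreAbstractSimplicialComplex.ext ?_
    simp only [PreAbstractSimplicialComplex.map, Set.image_image, Finset.image_image]

theorem congr (hf : IsSimplicialIso K L f) (h : ∀ v, {v} ∈ K.faces → f v = g v) :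
    IsSimplicialIso K L g := by
  refine ⟨hf.1.congr fun v hv => h v hv, ?_⟩
  rw [← hf.2]
  refine PreAbstractSimplicialComplex.ext (Set.image_congr fun A hA => ?_)
  exact Finset.image_congr fun v hv => (h v (singleton_mem_faces (Or.inr hA) hv)).symm

theorem refl (K : PreAbstractSimplicialComplex V) : IsSimplicialIso K K id := by
  refine ⟨Set.injOn_id _, PreAbstractSimplicialComplex.ext ?_⟩
  simp [PreAbstractSimplicialComplex.map]

/-- A realization of a complex gives one of each complex isomorphic to it. -/
def realization (h : IsSimplicialIso K L f) (R : CoxeterRealization L) :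
    CoxeterRealization K where
  n := R.n
  W := R.W
  isCoxeter := R.isCoxeter
  cell A := R.cell (A.image f)
  bijOn := by
    refine R.bijOn.comp ⟨fun A hA => h.image_mem hA, fun A hA B hB hAB => ?_, fun B hB => ?_⟩
    · exact h.image_injective hA hB hAB
    · exact h.exists_image_eq hB
  face_iff A hA B hB := by
    rw [← R.face_iff _ (h.image_mem hA) _ (h.image_mem hB)]
    exact ⟨Finset.image_subset_image, h.subset_of_image_subset hA hB⟩

variable {ι ι' : Type*} {M : SignModel ι K} {M' : SignModel ι' L}

/-- Open simplices are the maximal ones, so the sign models of the two complexes need not be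
related. -/
theorem isOpen_image (h : IsSimplicialIso K L f) {X : Finset V} (hX : M.IsOpen X) :
    M'.IsOpen (X.image f) := by
  obtain ⟨B', hB', hsub⟩ := M'.exists_isOpen_superset (h.image_mem hX.1)
  obtain ⟨B, hB, rfl⟩ := h.exists_image_eq hB'.1
  rwa [hX.eq_of_subset hB (h.subset_of_image_subset hX.1 hB hsub)]

/-- Isomorphisms of Coxeter complexes are determined by their values on a maximal simplex. -/
theorem eq_of_eqOn [Fintype ι] (M : SignModel ι K) (M' : SignModel ι' L)
    (hf : IsSimplicialIso K L f)
    (hg : IsSimplicialIso K L g) {C : Finset V} (hC : M.IsOpen C) (hCfg : ∀ v ∈ C, f v = g v)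
    {v : V} (hv : {v} ∈ K.faces) : f v = g v := by
  suffices H : ∀ n X, M.IsOpen X → M.sepCount X C = n → ∀ v ∈ X, f v = g v by
    obtain ⟨X, hX, hvX⟩ := M.exists_isOpen_superset (Or.inr hv)
    exact H _ X hX rfl v (hvX (Finset.mem_singleton_self v))
  intro n
  induction n using Nat.strong_induction_on with
  | _ n ih =>
    intro X hX hn
    by_cases h : C = X
    · exact h ▸ hCfg
    obtain ⟨F, Y, hY, hFX, hFY, hcard, hYc, hYX, hs⟩ := hX.exists_closer hC h
    have hYfg := ih _ (by omega) Y hY rfl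
    have hYim : Y.image f = Y.image g := Finset.image_congr fun w hw => hYfg w hw
    have hFim : F.image f = F.image g := Finset.image_congr fun w hw => hYfg w (hFY hw)
    have hF := mem_simplices_of_subset hX.1 hFX
    -- Both images are the second chamber on the image of `F`, next to the common image of `Y`. Only
    -- one vertex of `X` is outside `F`, so its value is then forced as well.
    have hXim : X.image f = X.image g := by
      refine SignModel.IsOpen.eq_of_ne_of_ne (M := M') (F := F.image f) (Y := Y.image f)
        (hf.isOpen_image hX) (hf.isOpen_image hY) (hg.isOpen_image hX)
        (Finset.image_subset_image hFX) (Finset.image_subset_image hFY)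
        (hFim ▸ Finset.image_subset_image hFX) ?_ ?_ ?_
      · rw [hf.card_image hF, hf.card_image hY.1, hYc, hcard]
      · exact fun e => hYX (hf.image_injective hX.1 hY.1 e).symm
      · rw [hYim]
        exact fun e => hYX (hg.image_injective hX.1 hY.1 e).symm
    intro v hv
    by_cases hvF : v ∈ F
    · exact hYfg v (hFY hvF)
    obtain ⟨w, hw, hwv⟩ := Finset.mem_image.1 (hXim ▸ Finset.mem_image_of_mem f hv)
    by_cases hwF : w ∈ F
    · exfalso
      rw [← hYfg w (hFY hwF)] at hwv
      exact hvF (hf.injOn hX.1 (hFX hwF) hv hwv ▸ hwF)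
    · have : w = v := by
        by_contra hne
        have hsub : insert w (insert v F) ⊆ X :=
          Finset.insert_subset hw (Finset.insert_subset hv hFX)
        have hle := Finset.card_le_card hsub
        rw [Finset.card_insert_of_notMem (by simp [hne, hwF]),
          Finset.card_insert_of_notMem hvF] at hle
        omega
      rw [← hwv, this]

end IsSimplicialIso

end Isomorphisms

namespace SphericalBuilding

variable {Δ : SphericalBuilding V}

section Galleries

open scoped Classical

/-! ### Chambers and galleries -/

theorem exists_signModel {S : PreAbstractSimplicialComplex V} (hS : S ∈ Δ.apartments) :
    ∃ (ι : Type) (_ : Fintype ι), Nonempty (SignModel ι S) := by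
  obtain ⟨R⟩ := Δ.coxeter S hS
  exact ⟨Wall R.W, Fintype.ofFinite _, ⟨R.signModel⟩⟩

theorem mem_simplexSet {S : PreAbstractSimplicialComplex V} (hS : S ∈ Δ.apartments)
    {A : Finset V} (hA : A ∈ simplices S) : A ∈ Δ.simplexSet :=
  hA.imp_right fun h => Δ.apartment_le S hS h

theorem IsChamber.card_eq {C D : Finset V} (hC : Δ.IsChamber C) (hD : Δ.IsChamber D) :
    C.card = D.card :=
  (hD.2 C hC.1).antisymm (hC.2 D hD.1)

/-- By (B2) every simplex of the building can be carried into `S` without change of dimension, and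
the open simplices of `S` all have the same dimension. So maximality in `S` and in `Δ` agree. -/
theorem isOpen_iff {S : PreAbstractSimplicialComplex V} (hS : S ∈ Δ.apartments) {ι : Type*}
    [Fintype ι] (M : SignModel ι S) {A : Finset V} :
    M.IsOpen A ↔ Δ.IsChamber A ∧ A ∈ simplices S := by
  have key : ∀ A, M.IsOpen A → Δ.IsChamber A := by
    intro A hA
    refine ⟨mem_simplexSet hS hA.1, fun B hB => ?_⟩
    obtain ⟨T, hT, hBT, -⟩ := Δ.common B hB ∅ (Or.inl rfl)
    obtain ⟨f, hf, -, -⟩ := Δ.iso T hT S hS ∅ ∅ (Or.inl rfl) (Or.inl rfl) (Or.inl rfl) (Or.inl rfl)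
    obtain ⟨B', hB', hsub⟩ := M.exists_isOpen_superset (hf.image_mem hBT)
    rw [← hf.card_image hBT, hA.card_eq hB']
    exact Finset.card_le_card hsub
  refine ⟨fun h => ⟨key A h, h.1⟩, fun ⟨hA, hAS⟩ => ?_⟩
  obtain ⟨B, hB, hsub⟩ := M.exists_isOpen_superset hAS
  rwa [Finset.eq_of_subset_of_card_le hsub (hA.2 B (key B hB).1)]

variable (Δ) in
/-- Two chambers are adjacent if they are different and share a panel. -/
def chamberGraph : SimpleGraph (Finset V) where
  Adj C D := C ≠ D ∧ Δ.IsChamber C ∧ Δ.IsChamber D ∧ ∃ P, P ⊆ C ∧ P ⊆ D ∧ P.card + 1 = C.card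
  symm := ⟨fun _ _ ⟨hne, hC, hD, P, hPC, hPD, h⟩ =>
    ⟨hne.symm, hD, hC, P, hPD, hPC, h.trans (hC.card_eq hD)⟩⟩
  loopless := ⟨fun _ h => h.1 rfl⟩

variable (Δ) in
/-- The gallery distance of chambers. -/
noncomputable abbrev gdist (C D : Finset V) : ℕ := Δ.chamberGraph.dist C D

theorem le_add_length {φ : Finset V → ℕ} (h : ∀ X Y, Δ.chamberGraph.Adj X Y → φ X ≤ φ Y + 1)
    {X Y : Finset V} (p : Δ.chamberGraph.Walk X Y) : φ X ≤ φ Y + p.length := by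
  induction p with
  | nil => simp
  | cons hadj p ih =>
    have := h _ _ hadj
    rw [SimpleGraph.Walk.length_cons]
    omega

theorem exists_walk {S : PreAbstractSimplicialComplex V} (hS : S ∈ Δ.apartments) {ι : Type*}
    [Fintype ι] (M : SignModel ι S) {X D : Finset V} (hX : M.IsOpen X) (hD : M.IsOpen D) :
    ∃ p : Δ.chamberGraph.Walk X D, p.length = M.sepCount X D := by
  induction hn : M.sepCount X D using Nat.strong_induction_on generalizing X with
  | _ n ih =>
    by_cases h : D = X
    · subst h
      exact ⟨.nil, by rw [← hn, SignModel.sepCount_self]; rfl⟩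
    · obtain ⟨F, Y, hY, hFX, hFY, hc, -, hYX, hs⟩ := hX.exists_closer hD h
      obtain ⟨p, hp⟩ := ih _ (by omega) hY rfl
      have hadj : Δ.chamberGraph.Adj X Y :=
        ⟨hYX.symm, ((isOpen_iff hS M).1 hX).1, ((isOpen_iff hS M).1 hY).1, F, hFX, hFY, hc⟩
      exact ⟨.cons hadj p, by rw [SimpleGraph.Walk.length_cons, hp, ← hs, hn]⟩

theorem reachable {C D : Finset V} (hC : Δ.IsChamber C) (hD : Δ.IsChamber D) :
    Δ.chamberGraph.Reachable C D := by
  obtain ⟨S, hS, hCS, hDS⟩ := Δ.common C hC.1 D hD.1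
  obtain ⟨ι, _, ⟨M⟩⟩ := exists_signModel hS
  obtain ⟨p, -⟩ := exists_walk hS M ((isOpen_iff hS M).2 ⟨hC, hCS⟩) ((isOpen_iff hS M).2 ⟨hD, hDS⟩)
  exact p.reachable

theorem gdist_le_add_one {X Y D : Finset V} (hXY : Δ.chamberGraph.Adj X Y)
    (hD : Δ.IsChamber D) : Δ.gdist X D ≤ Δ.gdist Y D + 1 := by
  obtain ⟨p, hp⟩ := (reachable hXY.2.2.1 hD).exists_walk_length_eq_dist
  change _ ≤ Δ.chamberGraph.dist Y D + 1
  rw [← hp, ← SimpleGraph.Walk.length_cons hXY p]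
  exact SimpleGraph.dist_le _

/-- The retraction of the building onto an apartment, centred at a chamber of it. -/
theorem exists_retraction {S : PreAbstractSimplicialComplex V} (hS : S ∈ Δ.apartments)
    {C : Finset V} (hC : Δ.IsChamber C) (hCS : C ∈ simplices S) :
    ∃ ρ : V → V, (∀ v, {v} ∈ S.faces → ρ v = v) ∧
      ∀ T ∈ Δ.apartments, C ∈ simplices T → IsSimplicialIso T S ρ := by
  have hex : ∀ v, ∃ T ∈ Δ.apartments, C ∈ simplices T ∧ {v} ∈ simplices T ∧
      ∃ f, IsSimplicialIso T S f ∧ ∀ w ∈ C, f w = w := by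
    intro v
    obtain ⟨T, hT, hCT, hvT⟩ := Δ.common C hC.1 {v} (Or.inr (Δ.complex.singleton_mem v))
    obtain ⟨f, hf, hfC, -⟩ := Δ.iso T hT S hS C C hCT hCT hCS hCS
    exact ⟨T, hT, hCT, hvT, f, hf, hfC⟩
  choose Tv hTv hCTv hvTv fv hfv hfvC using hex
  -- The value at `v` does not depend on the apartment: pass from `Tv v` to `T` by an isomorphism
  -- fixing `C` and `v`, and use rigidity of isomorphisms on `C`.
  have key : ∀ T ∈ Δ.apartments, C ∈ simplices T → ∀ f, IsSimplicialIso T S f →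
      (∀ w ∈ C, f w = w) → ∀ v, {v} ∈ T.faces → f v = fv v v := by
    intro T hT hCT f hf hfC v hv
    obtain ⟨g, hg, hgC, hgv⟩ := Δ.iso (Tv v) (hTv v) T hT C {v} (hCTv v) (hvTv v) hCT (Or.inr hv)
    obtain ⟨ι, _, ⟨M⟩⟩ := exists_signModel (hTv v)
    obtain ⟨ι', _, ⟨M'⟩⟩ := exists_signModel hS
    have := IsSimplicialIso.eq_of_eqOn M M' (hg.comp hf) (hfv v)
      ((isOpen_iff (hTv v) M).2 ⟨hC, hCTv v⟩)
      (fun w hw => by rw [Function.comp_apply, hgC w hw, hfC w hw, hfvC v w hw])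
      ((hvTv v).resolve_left (Finset.singleton_ne_empty v))
    rwa [Function.comp_apply, hgv v (Finset.mem_singleton_self v)] at this
  refine ⟨fun v => fv v v, fun v hv => ?_, fun T hT hCT => ?_⟩
  · exact (key S hS hCS id (IsSimplicialIso.refl S) (fun _ _ => rfl) v hv).symm
  · obtain ⟨f, hf, hfC, -⟩ := Δ.iso T hT S hS C C hCT hCT hCS hCS
    exact hf.congr (key T hT hCT f hf hfC)

theorem image_eq_self {S : PreAbstractSimplicialComplex V} {ρ : V → V}
    (hρ : ∀ v, {v} ∈ S.faces → ρ v = v) {A : Finset V} (hA : A ∈ simplices S) :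
    A.image ρ = A := by
  conv_rhs => rw [← Finset.image_id (s := A)]
  exact Finset.image_congr fun v hv => hρ v (singleton_mem_faces hA hv)

/-- A retraction turns a gallery into one with possible repetitions, and each step changes the
number of separating walls by at most one. -/
theorem sepCount_image_le_gdist {S : PreAbstractSimplicialComplex V} (hS : S ∈ Δ.apartments)
    {ι : Type*} [Fintype ι] (M : SignModel ι S) {C : Finset V} (hC : Δ.IsChamber C) {ρ : V → V}
    (hρ : ∀ v, {v} ∈ S.faces → ρ v = v)
    (hρ' : ∀ T ∈ Δ.apartments, C ∈ simplices T → IsSimplicialIso T S ρ)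
    {X D : Finset V} (hX : Δ.IsChamber X) (hD : M.IsOpen D) :
    M.sepCount (X.image ρ) D ≤ Δ.gdist X D := by
  have hopen : ∀ X, Δ.IsChamber X → M.IsOpen (X.image ρ) ∧ Set.InjOn ρ X := by
    intro X hX
    obtain ⟨T, hT, hCT, hXT⟩ := Δ.common C hC.1 X hX.1
    obtain ⟨ι', _, ⟨M'⟩⟩ := exists_signModel hT
    exact ⟨(hρ' T hT hCT).isOpen_image ((isOpen_iff hT M').2 ⟨hX, hXT⟩), (hρ' T hT hCT).injOn hXT⟩
  obtain ⟨p, hp⟩ := (reachable hX ((isOpen_iff hS M).1 hD).1).exists_walk_length_eq_dist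
  have := le_add_length (φ := fun X => M.sepCount (X.image ρ) D) ?_ p
  · rwa [image_eq_self hρ hD.1, SignModel.sepCount_self, zero_add, hp] at this
  · rintro X Y ⟨-, hX, hY, P, hPX, hPY, hcard⟩
    by_cases h : X.image ρ = Y.image ρ
    · simp [h]
    · have := (hopen X hX).1.sepCount_adjacent (F := P.image ρ) (hopen Y hY).1 hD h
        (Finset.image_subset_image hPX) (Finset.image_subset_image hPY) (by
          rw [Finset.card_image_of_injOn (hopen X hX).2,
            Finset.card_image_of_injOn ((hopen X hX).2.mono (Finset.coe_subset.2 hPX)), hcard])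
      change M.sepCount (X.image ρ) D ≤ M.sepCount (Y.image ρ) D + 1
      omega

/-- The gallery distance of two chambers is the number of walls of an apartment that separate
them. -/
theorem gdist_eq_sepCount {S : PreAbstractSimplicialComplex V} (hS : S ∈ Δ.apartments)
    {ι : Type*} [Fintype ι] (M : SignModel ι S) {X D : Finset V} (hX : M.IsOpen X)
    (hD : M.IsOpen D) : Δ.gdist X D = M.sepCount X D := by
  have hXc := ((isOpen_iff hS M).1 hX).1
  refine le_antisymm ?_ ?_
  · obtain ⟨p, hp⟩ := exists_walk hS M hX hD
    rw [← hp]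
    exact SimpleGraph.dist_le p
  · obtain ⟨ρ, hρ, hρ'⟩ := exists_retraction hS hXc hX.1
    have := sepCount_image_le_gdist hS M hXc hρ hρ' hXc hD
    rwa [image_eq_self hρ hX.1] at this

/-- Among the chambers that contain a given panel, all but one have the same distance from a given
chamber, and that one is closer. -/
theorem exists_gate {P X D : Finset V} (hX : Δ.IsChamber X) (hPX : P ⊆ X)
    (hcard : P.card + 1 = X.card) (hD : Δ.IsChamber D) :
    ∃ G, Δ.IsChamber G ∧ P ⊆ G ∧
      ∀ Y, Δ.IsChamber Y → P ⊆ Y → Y ≠ G → Δ.gdist Y D = Δ.gdist G D + 1 := by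
  have hex : ∃ n G, Δ.IsChamber G ∧ P ⊆ G ∧ Δ.gdist G D = n := ⟨_, X, hX, hPX, rfl⟩
  obtain ⟨G, hG, hPG, hGn⟩ := Nat.find_spec hex
  have hmin : ∀ Y, Δ.IsChamber Y → P ⊆ Y → Δ.gdist G D ≤ Δ.gdist Y D := fun Y hY hPY => by
    rw [hGn]
    exact Nat.find_min' hex ⟨Y, hY, hPY, rfl⟩
  have hPG' : P.card + 1 = G.card := hcard.trans (hX.card_eq hG)
  refine ⟨G, hG, hPG, fun Y hY hPY hYG => le_antisymm ?_ ?_⟩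
  · exact gdist_le_add_one ⟨hYG, hY, hG, P, hPY, hPG, hcard.trans (hX.card_eq hY)⟩ hD
  -- Retract, centred at `G`, onto an apartment through `G` and `D`. The image of `Y` is the
  -- neighbour of `G` across `P`, which is farther from `D` by the choice of `G`, and `Y` itself is
  -- no closer than its image.
  obtain ⟨S, hS, hGS, hDS⟩ := Δ.common G hG.1 D hD.1
  obtain ⟨ι, _, ⟨M⟩⟩ := exists_signModel hS
  obtain ⟨ρ, hρ, hρ'⟩ := exists_retraction hS hG hGS
  have hDo := (isOpen_iff hS M).2 ⟨hD, hDS⟩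
  have hGo := (isOpen_iff hS M).2 ⟨hG, hGS⟩
  have hle := sepCount_image_le_gdist hS M hG hρ hρ' hY hDo
  obtain ⟨T, hT, hGT, hYT⟩ := Δ.common G hG.1 Y hY.1
  obtain ⟨ι', _, ⟨M'⟩⟩ := exists_signModel hT
  have hYo : M.IsOpen (Y.image ρ) :=
    (hρ' T hT hGT).isOpen_image ((isOpen_iff hT M').2 ⟨hY, hYT⟩)
  have hPY' : P ⊆ Y.image ρ := by
    rw [← image_eq_self hρ (mem_simplices_of_subset hGS hPG)]
    exact Finset.image_subset_image hPY
  have hne : G ≠ Y.image ρ := by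
    intro e
    rw [← image_eq_self hρ hGS] at e
    exact hYG ((hρ' T hT hGT).image_injective hGT hYT e).symm
  have hmin' := hmin _ ((isOpen_iff hS M).1 hYo).1 hPY'
  rw [gdist_eq_sepCount hS M hYo hDo, gdist_eq_sepCount hS M hGo hDo] at hmin'
  rw [gdist_eq_sepCount hS M hGo hDo]
  have := hGo.sepCount_adjacent hYo hDo hne hPG hPY' hPG'
  omega

/-- Apartments are convex. -/
theorem mem_simplices_of_gdist {T : PreAbstractSimplicialComplex V} (hT : T ∈ Δ.apartments)
    {Y Y' D : Finset V} (hY : Y ∈ simplices T) (hD : Δ.IsChamber D) (hDT : D ∈ simplices T)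
    (hadj : Δ.chamberGraph.Adj Y Y') (hdist : Δ.gdist Y' D + 1 = Δ.gdist Y D) :
    Y' ∈ simplices T := by
  obtain ⟨hne, hYc, hYc', P, hPY, hPY', hcard⟩ := hadj
  obtain ⟨ι, _, ⟨M⟩⟩ := exists_signModel hT
  have hYo := (isOpen_iff hT M).2 ⟨hYc, hY⟩
  have hDo := (isOpen_iff hT M).2 ⟨hD, hDT⟩
  -- `Y'` is the gate of `D` on `P`. The neighbour `Z` of `Y` inside `T` has another distance from
  -- `D` than `Y`, so it is the gate too.
  obtain ⟨Z, hZo, hPZ, hZY, -⟩ := hYo.exists_adjacent hPY hcard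
  obtain ⟨G, hG, hPG, hgate⟩ := exists_gate hYc hPY hcard hD
  have hYG : Y ≠ G := by
    rintro rfl
    have := hgate Y' hYc' hPY' hne.symm
    omega
  have h1 := hgate Y hYc hPY hYG
  have hYG' : Y' = G := by
    by_contra h
    have := hgate Y' hYc' hPY' h
    omega
  have hZG : Z = G := by
    by_contra h
    have h2 := hgate Z ((isOpen_iff hT M).1 hZo).1 hPZ h
    rw [← h1, gdist_eq_sepCount hT M hZo hDo, gdist_eq_sepCount hT M hYo hDo] at h2
    have := hYo.sepCount_adjacent hZo hDo hZY.symm hPY hPZ hcard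
    omega
  rw [hYG', ← hZG]
  exact hZo.1

end Galleries

/-! ### Automorphisms -/

theorem map_mem_simplexSet {g : Equiv.Perm V} (hg : g ∈ Δ.aut) {A : Finset V}
    (hA : A ∈ Δ.simplexSet) : A.map g.toEmbedding ∈ Δ.simplexSet := by
  rcases hA with rfl | hA
  · exact Or.inl (Finset.map_empty _)
  · exact Or.inr ((hg A).2 hA)

theorem IsChamber.map {g : Equiv.Perm V} (hg : g ∈ Δ.aut) {C : Finset V} (hC : Δ.IsChamber C) :
    Δ.IsChamber (C.map g.toEmbedding) := by
  refine ⟨map_mem_simplexSet hg hC.1, fun A hA => ?_⟩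
  rw [Finset.card_map]
  exact hC.2 A hA

theorem map_inv_map (g : Equiv.Perm V) (A : Finset V) :
    (A.map g.toEmbedding).map (g⁻¹).toEmbedding = A := by
  have h : g.toEmbedding.trans (g⁻¹).toEmbedding = Function.Embedding.refl V := by
    ext x
    exact g.symm_apply_apply x
  rw [Finset.map_map, h, Finset.map_refl]

theorem adj_map {g : Equiv.Perm V} (hg : g ∈ Δ.aut) {C D : Finset V}
    (h : Δ.chamberGraph.Adj C D) :
    Δ.chamberGraph.Adj (C.map g.toEmbedding) (D.map g.toEmbedding) := by
  obtain ⟨hne, hC, hD, P, hPC, hPD, hcard⟩ := h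
  refine ⟨(Finset.map_injective _).ne hne, hC.map hg, hD.map hg, P.map g.toEmbedding,
    Finset.map_subset_map.2 hPC, Finset.map_subset_map.2 hPD, ?_⟩
  rw [Finset.card_map, Finset.card_map, hcard]

theorem gdist_map {g : Equiv.Perm V} (hg : g ∈ Δ.aut) {C D : Finset V} (hC : Δ.IsChamber C)
    (hD : Δ.IsChamber D) :
    Δ.gdist (C.map g.toEmbedding) (D.map g.toEmbedding) = Δ.gdist C D := by
  have key : ∀ (g : Equiv.Perm V), g ∈ Δ.aut → ∀ C D, Δ.IsChamber C → Δ.IsChamber D →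
      Δ.gdist (C.map g.toEmbedding) (D.map g.toEmbedding) ≤ Δ.gdist C D := by
    intro g hg C D hC hD
    obtain ⟨p, hp⟩ := (reachable hC hD).exists_walk_length_eq_dist
    change _ ≤ Δ.chamberGraph.dist C D
    rw [← hp, ← SimpleGraph.Walk.length_map
      (⟨fun A => A.map g.toEmbedding, fun h => adj_map hg h⟩ : Δ.chamberGraph →g Δ.chamberGraph) p]
    exact SimpleGraph.dist_le _
  refine le_antisymm (key g hg C D hC hD) ?_
  have := key g⁻¹ (inv_mem hg) _ _ (hC.map hg) (hD.map hg)
  rwa [map_inv_map, map_inv_map] at this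

/-- The image of an apartment under an automorphism lies in any apartment that contains the images
of two opposite chambers. -/
theorem map_mem_simplices {S T : PreAbstractSimplicialComplex V} (hS : S ∈ Δ.apartments)
    (hT : T ∈ Δ.apartments) {ι : Type*} [Fintype ι] (M : SignModel ι T) {h : Equiv.Perm V}
    (hh : h ∈ Δ.aut) {D D' : Finset V} (hD : M.IsOpen D) (hD' : M.IsOpen D')
    (hneg : M.sgn D' = -M.sgn D) (hDS : D.map h.toEmbedding ∈ simplices S)
    (hDS' : D'.map h.toEmbedding ∈ simplices S) {X : Finset V} (hX : M.IsOpen X) :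
    X.map h.toEmbedding ∈ simplices S := by
  have hc : ∀ {X}, M.IsOpen X → Δ.IsChamber X := fun hX => ((isOpen_iff hT M).1 hX).1
  induction hn : M.sepCount X D using Nat.strong_induction_on generalizing X with
  | _ n ih =>
    by_cases hDX : D = X
    · rwa [← hDX]
    obtain ⟨F, Y, hY, hFX, hFY, hcard, hYc, hYX, hs⟩ := hX.exists_closer hD hDX
    have hYS := ih _ (by omega) hY rfl
    -- A step away from `D` is a step towards `D'`, so convexity with respect to the image of `D'`
    -- keeps the gallery in `S`.
    refine mem_simplices_of_gdist hS hYS ((hc hD').map hh) hDS'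
      (adj_map hh ⟨hYX, hc hY, hc hX, F, hFY, hFX, hcard.trans hYc.symm⟩) ?_
    rw [gdist_map hh (hc hX) (hc hD'), gdist_map hh (hc hY) (hc hD'),
      gdist_eq_sepCount hT M hX hD', gdist_eq_sepCount hT M hY hD']
    have h1 := SignModel.sepCount_add_of_eq_neg hX hD hneg
    have h2 := SignModel.sepCount_add_of_eq_neg hY hD hneg
    omega

/-! ### Opposite chambers -/

variable (Δ) in
/-- The apartments of `Δ` have `N` walls. -/
def HasWallCount (N : ℕ) : Prop :=
  ∀ T ∈ Δ.apartments, ∃ R : CoxeterRealization T, Nat.card (Wall R.W) = N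

/-- One realization is transported to all apartments, so they share one Coxeter group and one `N`.
-/
theorem exists_hasWallCount {S : PreAbstractSimplicialComplex V} (hS : S ∈ Δ.apartments) :
    ∃ N, Δ.HasWallCount N := by
  obtain ⟨R⟩ := Δ.coxeter S hS
  refine ⟨Nat.card (Wall R.W), fun T hT => ?_⟩
  obtain ⟨f, hf, -, -⟩ := Δ.iso T hT S hS ∅ ∅ (Or.inl rfl) (Or.inl rfl) (Or.inl rfl) (Or.inl rfl)
  exact ⟨hf.realization R, rfl⟩

theorem HasWallCount.exists_signModel {N : ℕ} (hN : Δ.HasWallCount N)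
    {T : PreAbstractSimplicialComplex V} (hT : T ∈ Δ.apartments) :
    ∃ (ι : Type) (_ : Fintype ι) (M : SignModel ι T), Fintype.card ι = N ∧
      ∀ A ∈ simplices T, ∀ B ∈ simplices T, M.sgn B = -M.sgn A → Antipodal T A B := by
  obtain ⟨R, hR⟩ := hN T hT
  let hW : Fintype (Wall R.W) := Fintype.ofFinite _
  refine ⟨Wall R.W, hW, R.signModel, ?_, fun A hA B hB h => ?_⟩
  · rw [← hR, Nat.card_eq_fintype_card]
  · exact R.antipodal_of_sgn hA hB h

theorem HasWallCount.gdist_le {N : ℕ} (hN : Δ.HasWallCount N) {C D : Finset V}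
    (hC : Δ.IsChamber C) (hD : Δ.IsChamber D) : Δ.gdist C D ≤ N := by
  obtain ⟨T, hT, hCT, hDT⟩ := Δ.common C hC.1 D hD.1
  obtain ⟨ι, _, M, rfl, -⟩ := hN.exists_signModel hT
  rw [gdist_eq_sepCount hT M ((isOpen_iff hT M).2 ⟨hC, hCT⟩) ((isOpen_iff hT M).2 ⟨hD, hDT⟩)]
  exact SignModel.sepCount_le C D

theorem HasWallCount.opposite {N : ℕ} (hN : Δ.HasWallCount N) {C D : Finset V}
    (hC : Δ.IsChamber C) (hD : Δ.IsChamber D) (h : Δ.gdist C D = N) : Δ.Opposite D C := by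
  obtain ⟨T, hT, hCT, hDT⟩ := Δ.common C hC.1 D hD.1
  obtain ⟨ι, _, M, rfl, hanti⟩ := hN.exists_signModel hT
  have hCo := (isOpen_iff hT M).2 ⟨hC, hCT⟩
  have hDo := (isOpen_iff hT M).2 ⟨hD, hDT⟩
  rw [gdist_eq_sepCount hT M hCo hDo, ← hCo.sgn_eq_neg_iff hDo] at h
  exact ⟨T, hT, hanti D hDT C hCT h⟩

theorem HasWallCount.exists_farther {N : ℕ} (hN : Δ.HasWallCount N) {C D : Finset V}
    (hC : Δ.IsChamber C) (hD : Δ.IsChamber D) (h : Δ.gdist C D ≠ N) :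
    ∃ P Y, Δ.IsChamber Y ∧ P ⊆ C ∧ P ⊆ Y ∧ P.card + 1 = C.card ∧
      Δ.gdist Y D = Δ.gdist C D + 1 := by
  obtain ⟨T, hT, hCT, hDT⟩ := Δ.common C hC.1 D hD.1
  obtain ⟨ι, _, M, rfl, -⟩ := hN.exists_signModel hT
  have hCo := (isOpen_iff hT M).2 ⟨hC, hCT⟩
  have hDo := (isOpen_iff hT M).2 ⟨hD, hDT⟩
  rw [gdist_eq_sepCount hT M hCo hDo, Ne, ← hCo.sgn_eq_neg_iff hDo] at h
  obtain ⟨P, Y, hY, hPC, hPY, hcard, -, -, hs⟩ := hCo.exists_farther hDo h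
  refine ⟨P, Y, ((isOpen_iff hT M).1 hY).1, hPC, hPY, hcard, ?_⟩
  rw [gdist_eq_sepCount hT M hY hDo, gdist_eq_sepCount hT M hCo hDo, hs]

/-- An apartment all of whose chambers have maximal distance from `C` lies in the opposition
complex of `C`. -/
theorem HasWallCount.le_opp {N : ℕ} (hN : Δ.HasWallCount N) {T : PreAbstractSimplicialComplex V}
    (hT : T ∈ Δ.apartments) {C : Finset V} (hC : Δ.IsChamber C)
    (h : ∀ X ∈ Δ.chambersIn T, Δ.gdist C X = N) : T ≤ Δ.opp C := by
  intro A hA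
  obtain ⟨ι, _, ⟨M⟩⟩ := SphericalBuilding.exists_signModel hT
  obtain ⟨X, hX, hAX⟩ := M.exists_isOpen_superset (Or.inr hA)
  have hX' := (isOpen_iff hT M).1 hX
  exact ⟨(T.isRelLowerSet_faces hA).1,
    (hN.opposite hC hX'.1 (h X hX')).exists_face hAX⟩

theorem thickness_le {P : Finset V} (hP : Δ.IsPanel P) :
    Δ.thickness ≤ Set.encard {C | Δ.IsChamber C ∧ P ⊆ C} :=
  sSup_le fun _ ht => ht P hP

/-- In a sufficiently thick building some chamber is opposite to all chambers of a given
apartment. -/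
theorem HasWallCount.exists_opposite_all {N : ℕ} (hN : Δ.HasWallCount N)
    {S : PreAbstractSimplicialComplex V} (hS : S ∈ Δ.apartments)
    (hth : (Δ.chambersIn S).encard < Δ.thickness) :
    ∃ C, Δ.IsChamber C ∧ ∀ D ∈ Δ.chambersIn S, Δ.gdist C D = N := by
  have hfin : (Δ.chambersIn S).Finite := Set.encard_lt_top_iff.1 (hth.trans_le le_top)
  obtain ⟨C₀, hC₀⟩ : ∃ C, Δ.IsChamber C := by
    obtain ⟨ι, _, ⟨M⟩⟩ := SphericalBuilding.exists_signModel hS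
    obtain ⟨X, hX, -⟩ := M.exists_isOpen_superset (Or.inl rfl)
    exact ⟨X, ((isOpen_iff hS M).1 hX).1⟩
  -- Distances are at most `N`, so this sum has a maximum even if the building is infinite.
  let φ : Finset V → ℕ := fun C => ∑ D ∈ hfin.toFinset, Δ.gdist C D
  have hbdd : BddAbove (φ '' {C | Δ.IsChamber C}) := by
    refine ⟨∑ D ∈ hfin.toFinset, N, ?_⟩
    rintro _ ⟨C, hC, rfl⟩
    exact Finset.sum_le_sum fun D hD => hN.gdist_le hC (hfin.mem_toFinset.1 hD).1
  obtain ⟨C, hC, hCmax⟩ := Nat.sSup_mem (Set.Nonempty.image φ ⟨C₀, hC₀⟩) hbdd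
  have hmax : ∀ C', Δ.IsChamber C' → φ C' ≤ φ C := fun C' hC' => by
    rw [hCmax]
    exact le_csSup hbdd ⟨C', hC', rfl⟩
  refine ⟨C, hC, ?_⟩
  by_contra! H
  obtain ⟨D₀, hD₀, hne⟩ := H
  obtain ⟨P, Y, hY, hPC, hPY, hcard, hYD⟩ := hN.exists_farther hC hD₀.1 hne
  have hgate : ∀ D, ∃ G, Δ.IsChamber D → Δ.IsChamber G ∧ P ⊆ G ∧
      ∀ Y, Δ.IsChamber Y → P ⊆ Y → Y ≠ G → Δ.gdist Y D = Δ.gdist G D + 1 := by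
    intro D
    by_cases hD : Δ.IsChamber D
    · obtain ⟨G, hG⟩ := exists_gate hC hPC hcard hD
      exact ⟨G, fun _ => hG⟩
    · exact ⟨∅, fun h => absurd h hD⟩
  choose γ hγ using hgate
  have hP : Δ.IsPanel P := by
    refine ⟨?_, C, hC, hcard⟩
    exact mem_simplices_of_subset hC.1 hPC
  -- A chamber on `P` that is the gate of no chamber of `S`; it attains on `P` the maximal distance
  -- to all of them at once.
  obtain ⟨C', ⟨hC', hPC'⟩, hC'γ⟩ : ∃ C' ∈ {C | Δ.IsChamber C ∧ P ⊆ C},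
      C' ∉ γ '' Δ.chambersIn S := by
    by_contra! hsub
    have h1 : Set.encard {C | Δ.IsChamber C ∧ P ⊆ C} ≤ (γ '' Δ.chambersIn S).encard :=
      Set.encard_le_encard hsub
    exact absurd hth (not_lt.2 ((thickness_le hP).trans (h1.trans (Set.encard_image_le _ _))))
  have hdist : ∀ D ∈ Δ.chambersIn S, Δ.gdist C' D = Δ.gdist (γ D) D + 1 := fun D hD =>
    (hγ D hD.1).2.2 C' hC' hPC' fun e => hC'γ ⟨D, hD, e.symm⟩
  have hle : ∀ Y, Δ.IsChamber Y → P ⊆ Y → ∀ D ∈ Δ.chambersIn S,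
      Δ.gdist Y D ≤ Δ.gdist (γ D) D + 1 := by
    intro Y hY hPY D hD
    by_cases h : Y = γ D
    · rw [← h]
      omega
    · exact ((hγ D hD.1).2.2 Y hY hPY h).le
  refine absurd (hmax C' hC') (not_le.2 (Finset.sum_lt_sum (fun D hD => ?_) ⟨D₀, ?_, ?_⟩))
  · have hD := hfin.mem_toFinset.1 hD
    rw [hdist D hD]
    exact hle C hC hPC D hD
  · exact hfin.mem_toFinset.2 hD₀
  · rw [hdist D₀ hD₀]
    have := hle Y hY hPY D₀ hD₀
    omega

end SphericalBuilding

end Bldg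

theorem mainTheorem7 {V : Type*} (Δ : Bldg.SphericalBuilding V)
    (S : PreAbstractSimplicialComplex V) (hS : S ∈ Δ.apartments)
    (hth : (Δ.chambersIn S).encard < Δ.thickness) :
    (∃ C, Δ.IsChamber C ∧ S ≤ Δ.opp C) ∧
      (Δ.ChamberTransitive →
        ∀ C, Δ.IsChamber C → ∃ T ∈ Δ.apartments, T ≤ Δ.opp C) := by
  obtain ⟨N, hN⟩ := Bldg.SphericalBuilding.exists_hasWallCount hS
  obtain ⟨C₀, hC₀, hopp⟩ := hN.exists_opposite_all hS hth
  refine ⟨⟨C₀, hC₀, hN.le_opp hS hC₀ hopp⟩, fun htrans C hC => ?_⟩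
  obtain ⟨g, hg, rfl⟩ := htrans C₀ C hC₀ hC
  obtain ⟨ι, _, M, hMN, -⟩ := hN.exists_signModel hS
  obtain ⟨D, hD, -⟩ := M.exists_isOpen_superset (Or.inl rfl)
  obtain ⟨D', hD', hneg⟩ := hD.exists_neg
  have hDc := ((Bldg.SphericalBuilding.isOpen_iff hS M).1 hD).1
  have hDc' := ((Bldg.SphericalBuilding.isOpen_iff hS M).1 hD').1
  -- `T` serves as a substitute for the image of `S` under `g`, which need not be an apartment.
  obtain ⟨T, hT, hDT, hDT'⟩ := Δ.common _ (hDc.map hg).1 _ (hDc'.map hg).1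
  refine ⟨T, hT, hN.le_opp hT hC fun X hX => ?_⟩
  obtain ⟨ι', _, M', hMN', -⟩ := hN.exists_signModel hT
  have hDo := (Bldg.SphericalBuilding.isOpen_iff hT M').2 ⟨hDc.map hg, hDT⟩
  have hDo' := (Bldg.SphericalBuilding.isOpen_iff hT M').2 ⟨hDc'.map hg, hDT'⟩
  -- Opposition survives `g` because it means gallery distance `N`, with the same `N` for `S` and
  -- `T`.
  have hneg' : M'.sgn (D'.map g.toEmbedding) = -M'.sgn (D.map g.toEmbedding) := by
    rw [hDo'.sgn_eq_neg_iff hDo, ← Bldg.SphericalBuilding.gdist_eq_sepCount hT M' hDo' hDo,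
      Bldg.SphericalBuilding.gdist_map hg hDc' hDc,
      Bldg.SphericalBuilding.gdist_eq_sepCount hS M hD' hD, hMN', ← hMN, ← hD'.sgn_eq_neg_iff hD,
      hneg]
  have hXS := Bldg.SphericalBuilding.map_mem_simplices hS hT M' (inv_mem hg) hDo hDo' hneg'
    (by rw [Bldg.SphericalBuilding.map_inv_map]; exact hD.1)
    (by rw [Bldg.SphericalBuilding.map_inv_map]; exact hD'.1)
    ((Bldg.SphericalBuilding.isOpen_iff hT M').2 hX)
  have hXc := hX.1.map (inv_mem hg)
  rw [← hopp _ ⟨hXc, hXS⟩, ← Bldg.SphericalBuilding.gdist_map (inv_mem hg) hC hX.1,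
    Bldg.SphericalBuilding.map_inv_map]
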